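/- Let $\mathbb{K}$ be an algebraically closed field, $n>1$, and let $Q\subset\mathbb{K}[[X_1,\dots,X_n]]$ be an algebroid curve, that is, a proper radical ideal with minimal primes $P_1,\dots,P_r$ (so $Q=\bigcap_{i=1}^r P_i$) such that each $\mathcal{O}_i=\mathbb{K}[[X_1,\dots,X_n]]/P_i$ has Krull dimension one. Assume $r\ge 2$. Put $I=\{1,\dots,r\}$, $\mathcal{O}=\mathbb{K}[[X_1,\dots,X_n]]/Q$, let $\mathcal{M}$ be the maximal ideal of $\mathcal{O}$, and assume that $Q$ is non-degenerate: $\dim_{\mathbb{K}}\mathcal{M}/\mathcal{M}^2=n$. For $g\in\mathcal{O}$ let $v(g)=(v_1(g),\dots,v_r(g))\in\overline{\mathbb{N}}^r$, $\overline{\mathbb N}=\mathbb{N}\cup\{\infty\}$, where $v_i(g)$ is the value of the image of $g$ in $\mathcal{O}_i$ under the normalized discrete valuation of the integral closure of $\mathcal{O}_i$ in its field of fractions ($v_i(g)=\infty$ if this image is $0$). Let $\Gamma=v(\mathcal{O})$, with componentwise addition, and for $\gamma\in\Gamma$ let $I_\gamma=\{i\in I:\gamma_i\ne\infty\}$. An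 element $\gamma\in\Gamma\setminus\{(0,\dots,0)\}$ is irreducible if $\gamma=\alpha+\beta$ with $\alpha,\beta\in\Gamma$ implies $\alpha=\gamma$ or $\beta=\gamma$. An element $\gamma\in\Gamma$ is an absolute point if for every nonempty proper subset $J\subsetneq I_\gamma$ there is no $\alpha\in\Gamma$ with $\alpha_i>\gamma_i$ for all $i\in I_\gamma\setminus J$ and $\alpha_j=\gamma_j$ for all $j\notin I_\gamma\setminus J$. For a finite set $G=\{g_1,\dots,g_m\}\subset\mathcal{M}$, a nonzero $g\in\mathcal{O}$ has a reduction modulo $G$ if there are $c\in\mathbb{K}$, $\alpha\in\mathbb{N}^m$ and $k\in I_{v(g)}$ such that $h=g-c\,g_1^{\alpha_1}\cdots g_m^{\alpha_m}$ satisfies $v_i(h)\ge v_i(g)$ for all $i\in I$ and $v_k(h)>v_k(g)$. A nonempty finite set $G\subset\mathcal{M}\setminus\{0\}$ is a Standard Basis for $\mathcal{O}$ if every nonzero $g\in\mathcal{O}$ has a reduction modulo $G$; it is minimal if moreover no $g\in G$ has a reduction modulo $G\setminus\{g\}$. Then: if $G$ is a finite subset of $\mathcal{M}$ whose elements have pairwise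 distinct values and whose value set $v(G)=\{v(g):g\in G\}$ is precisely the set of irreducible absolute points of $\Gamma$, then $G$ is a minimal Standard Basis for $\mathcal{O}$. -/

import Mathlib

noncomputable section

/-- The order of `x` with respect to the Jacobson radical `J` of the ring `B`, i.e. the supremum in
`ℕ ∪ {∞}` of the `k` with `x ∈ J ^ k`. When `B` is a discrete valuation ring this is its normalized
discrete valuation (with value `∞` at `0`), see `radicalOrder_eq_addVal`. -/
def radicalOrder (B : Type*) [CommRing B] (x : B) : ℕ∞ :=
  ⨆ (k : ℕ) (_ : x ∈ Ring.jacobson B ^ k), (k : ℕ∞)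

/-- On a discrete valuation ring, `radicalOrder` is the normalized additive valuation. -/
theorem radicalOrder_eq_addVal (B : Type*) [CommRing B] [IsDomain B] [IsDiscreteValuationRing B]
    (x : B) : radicalOrder B x = IsDiscreteValuationRing.addVal B x := by
  obtain ⟨ϖ, hϖ⟩ := IsDiscreteValuationRing.exists_irreducible B
  have key : ∀ k : ℕ, x ∈ Ring.jacobson B ^ k ↔
      (k : ℕ∞) ≤ IsDiscreteValuationRing.addVal B x := by
    intro k
    rw [IsLocalRing.ringJacobson_eq_maximalIdeal, hϖ.maximalIdeal_eq, Ideal.span_singleton_pow,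
      Ideal.mem_span_singleton, ← IsDiscreteValuationRing.addVal_le_iff_dvd,
      IsDiscreteValuationRing.addVal_pow, IsDiscreteValuationRing.addVal_uniformizer hϖ]
    simp
  unfold radicalOrder
  simp only [key]
  apply le_antisymm
  · exact iSup₂_le fun k hk => hk
  · refine ENat.forall_natCast_le_iff_le.mp fun k hk => ?_
    exact le_iSup₂_of_le k hk le_rfl

/-- An algebroid curve in `n`-space over `K` (`n > 1`): a proper radical ideal `Q` of
`K[[X_1, …, X_n]]` such that the quotient by each isolated (that is, minimal) prime of `Q` has
Krull dimension one. -/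
structure AlgebroidCurve (K : Type*) [Field K] (n : ℕ) where
  ideal : Ideal (MvPowerSeries (Fin n) K)
  one_lt : 1 < n
  ne_top : ideal ≠ ⊤
  isRadical : ideal.IsRadical
  krullDim_eq_one : ∀ P ∈ ideal.minimalPrimes, ringKrullDim (MvPowerSeries (Fin n) K ⧸ P) = 1

namespace AlgebroidCurve

variable {K : Type*} [Field K] {n : ℕ} (C : AlgebroidCurve K n)

/-- The ring `𝒪 = K[[X]] / Q` of the curve. -/
abbrev CoordRing : Type _ := MvPowerSeries (Fin n) K ⧸ C.ideal

instance : Nontrivial C.CoordRing := Ideal.Quotient.nontrivial_iff.mpr C.ne_top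

instance : IsLocalRing C.CoordRing :=
  IsLocalRing.of_surjective' (Ideal.Quotient.mk C.ideal) Ideal.Quotient.mk_surjective

/-- The maximal ideal `ℳ` of `𝒪`. -/
abbrev maxIdeal : Ideal C.CoordRing := IsLocalRing.maximalIdeal C.CoordRing

/-- The curve is non-degenerate: `dim_K (ℳ / ℳ²) = n`. -/
def Nondegenerate : Prop := Module.finrank K C.maxIdeal.Cotangent = n

/-- The index set `I` of the branches: the minimal primes of `Q`. -/
abbrev Branch : Type _ := C.ideal.minimalPrimes

/-- The ring `𝒪_i = K[[X]] / P_i` of a branch. -/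
abbrev BranchRing (i : C.Branch) : Type _ := MvPowerSeries (Fin n) K ⧸ i.1

/-- The integral closure of `𝒪_i` in its field of fractions. -/
abbrev BranchNormalization (i : C.Branch) : Type _ :=
  integralClosure (C.BranchRing i) (FractionRing (C.BranchRing i))

/-- The canonical surjection `𝒪 → 𝒪_i`. -/
def toBranch (i : C.Branch) : C.CoordRing →+* C.BranchRing i :=
  Ideal.Quotient.factor i.2.1.2

/-- The value vector `v(g) = (v_i(g))_i`, where `v_i(g)` is the value of the image of `g` in `𝒪_i`
under the normalized valuation of the integral closure of `𝒪_i`. -/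
def value (g : C.CoordRing) : C.Branch → ℕ∞ := fun i =>
  radicalOrder (C.BranchNormalization i)
    (algebraMap (C.BranchRing i) (C.BranchNormalization i) (C.toBranch i g))

/-- The set `Γ = v(𝒪)` of values of the curve. -/
def valueSet : Set (C.Branch → ℕ∞) := Set.range C.value

/-- `I_γ`, the set of the branches at which `γ` is finite. -/
def finiteSupport (γ : C.Branch → ℕ∞) : Set C.Branch := {i | γ i ≠ ⊤}

/-- `h` is a `k`-reduction of `g` modulo `G`: `k ∈ I_g` and `h = g - c G^α` for some `c ∈ K` and
some `G`-product `G^α`, with `v_i(h) ≥ v_i(g)` for all `i` and `v_k(h) > v_k(g)`. -/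
def IsReductionAt (G : Finset C.CoordRing) (k : C.Branch) (g h : C.CoordRing) : Prop :=
  g ≠ 0 ∧ k ∈ C.finiteSupport (C.value g) ∧
    (∃ (c : K) (α : C.CoordRing → ℕ), h = g - algebraMap K C.CoordRing c * ∏ x ∈ G, x ^ α x) ∧
    (∀ i, C.value g i ≤ C.value h i) ∧ C.value g k < C.value h k

/-- `g` has a reduction modulo `G`. -/
def HasReduction (G : Finset C.CoordRing) (g : C.CoordRing) : Prop :=
  ∃ (k : C.Branch) (h : C.CoordRing), C.IsReductionAt G k g h

/-- `G` is a Standard Basis for `𝒪`. -/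
def IsStandardBasis (G : Finset C.CoordRing) : Prop :=
  G.Nonempty ∧ (∀ g ∈ G, g ∈ C.maxIdeal ∧ g ≠ 0) ∧ ∀ g : C.CoordRing, g ≠ 0 → C.HasReduction G g

open Classical in
/-- `G` is a minimal Standard Basis for `𝒪`: no `g ∈ G` has a reduction modulo `G \ {g}`. -/
def IsMinimalStandardBasis (G : Finset C.CoordRing) : Prop :=
  C.IsStandardBasis G ∧ ∀ g ∈ G, ¬ C.HasReduction (G.erase g) g

/-- `γ` is an irreducible element of `Γ`. -/
def IsIrreducibleValue (γ : C.Branch → ℕ∞) : Prop :=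
  γ ∈ C.valueSet ∧ γ ≠ 0 ∧
    ∀ α ∈ C.valueSet, ∀ β ∈ C.valueSet, γ = α + β → α = γ ∨ β = γ

/-- The set `F_J(γ)` of the `α ∈ Γ` with `α_i > γ_i` for `i ∈ I_γ \ J` and `α_j = γ_j` for all
other `j`. -/
def fiber (J : Set C.Branch) (γ : C.Branch → ℕ∞) : Set (C.Branch → ℕ∞) :=
  {α | α ∈ C.valueSet ∧ (∀ i ∈ C.finiteSupport γ \ J, γ i < α i) ∧
    ∀ j, j ∉ C.finiteSupport γ \ J → α j = γ j}

/-- `γ ∈ Γ` is an absolute point of `Γ`: `F_J(γ) = ∅` for every nonempty `J ⊊ I_γ`. (The empty `J`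
has to be left out, since `F_∅(γ)` always contains the value `(∞, …, ∞)` of `0`.) -/
def IsAbsolutePoint (γ : C.Branch → ℕ∞) : Prop :=
  γ ∈ C.valueSet ∧
    ∀ J : Set C.Branch, J.Nonempty → J ⊂ C.finiteSupport γ → C.fiber J γ = ∅

end AlgebroidCurve

end

/-! Each branch normalization is a discrete valuation ring with residue field `K`, so equal finite
initial terms can be cancelled by a constant. Hence `g` has a reduction modulo `G` iff some
`G`-product `p` satisfies `v(p) ≥ v(g)` with equality at a finite component `k`
(`hasReduction_of_value_prod`, `HasReduction.exists_value_prod`), and the theorem becomes a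
statement about `Γ`.

Existence: among the values above `v(g)` with the same finite `k`-th component there is a maximal
one, because a nonzero conductor allows large components to be replaced by `∞`, leaving finitely
many candidates (`exists_maximal_value`). Such a value is an absolute point
(`isAbsolutePoint_of_maximal`). If it is nonzero and not irreducible, it splits into two values with
smaller `k`-th components, and induction on that component applies (`exists_prod_value`).

Minimality: a product reducing `g ∈ G` has value exactly `v(g)`, since `v(g)` is absolute; by
irreducibility one of its factors has this value, and distinctness of values makes that factor `g`
itself.

For the valuation rings, a branch ring `A` is finite over `K⟦t⟧`. A valuation ring dominating `A` is
then also finite over `K⟦t⟧`, by a rank bound, and so coincides with the normalization. -/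

noncomputable section

/-! ### Modules and algebras over `K⟦X⟧` -/

open PowerSeries in
/-- A module over `K⟦X⟧` which is `X`-adically separated is generated by every finite family that
generates it modulo `X`. -/
theorem PowerSeries.span_range_eq_top_of_separated {K M ι : Type*} [Field K] [AddCommGroup M]
    [Module K⟦X⟧ M] [Fintype ι] (y : ι → M)
    (hsep : ∀ z : M, (∀ N : ℕ, ∃ w, z = (X : K⟦X⟧) ^ N • w) → z = 0)
    (hgen : ∀ x : M, ∃ (c : ι → K) (x' : M), x = ∑ i, (C (c i) : K⟦X⟧) • y i + (X : K⟦X⟧) • x') :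
    Submodule.span K⟦X⟧ (Set.range y) = ⊤ := by
  choose c r hcr using hgen
  refine eq_top_iff.mpr fun x _ => ?_
  -- Iterating the remainder map `r` peels off one `X`-adic digit at a time; `f i` collects the
  -- digits.
  let f : ι → K⟦X⟧ := fun i => PowerSeries.mk fun k => c (r^[k] x) i
  have key : ∀ N : ℕ,
      x = ∑ i, ((trunc N (f i) : Polynomial K) : K⟦X⟧) • y i + (X : K⟦X⟧) ^ N • r^[N] x := by
    intro N
    induction N with
    | zero => simp
    | succ N ih =>
      have h1 : ∀ i, ((trunc (N + 1) (f i) : Polynomial K) : K⟦X⟧) =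
          ((trunc N (f i) : Polynomial K) : K⟦X⟧) + (X : K⟦X⟧) ^ N * C (c (r^[N] x) i) := by
        intro i
        rw [trunc_succ, Polynomial.coe_add, Polynomial.coe_monomial, monomial_eq_C_mul_X_pow,
          mul_comm]
        simp [f]
      conv_lhs => rw [ih, hcr (r^[N] x)]
      simp only [h1, add_smul, Finset.sum_add_distrib, smul_add, Finset.smul_sum, smul_smul,
        pow_succ, Function.iterate_succ_apply', add_assoc]
  have hx : x = ∑ i, f i • y i := by
    rw [← sub_eq_zero]
    refine hsep _ fun N => ?_
    refine ⟨r^[N] x - ∑ i, (PowerSeries.mk fun k => coeff (k + N) (f i)) • y i, ?_⟩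
    conv_lhs => rw [key N]
    have h2 : ∀ i, f i • y i = (X : K⟦X⟧) ^ N • (PowerSeries.mk fun k => coeff (k + N) (f i)) • y i +
        ((trunc N (f i) : Polynomial K) : K⟦X⟧) • y i := by
      intro i
      conv_lhs => rw [eq_X_pow_mul_shift_add_trunc N (f i), add_smul, mul_smul]
    rw [Finset.sum_congr rfl fun i _ => h2 i, Finset.sum_add_distrib, smul_sub, Finset.smul_sum]
    abel
  rw [hx]
  exact Submodule.sum_mem _ fun i _ => Submodule.smul_mem _ _ (Submodule.subset_span ⟨i, rfl⟩)

/-- Every power series is, modulo the `N`-th powers of the variables, a linear combination of the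
monomials with exponents less than `N`. -/
theorem MvPowerSeries.exists_eq_sum_monomial_add_sum_X_pow_mul {K : Type*} [Field K] {n : ℕ}
    (N : ℕ) (f : MvPowerSeries (Fin n) K) :
    ∃ (c : (Fin n → Fin N) → K) (g : Fin n → MvPowerSeries (Fin n) K),
      f = ∑ a, MvPowerSeries.monomial (Finsupp.equivFunOnFinite.symm fun j => (a j : ℕ)) (c a) +
        ∑ j, MvPowerSeries.X j ^ N * g j := by
  classical
  have step : ∀ (S : Finset (Fin n)) (f : MvPowerSeries (Fin n) K),
      ∃ (h : MvPowerSeries (Fin n) K) (g : Fin n → MvPowerSeries (Fin n) K),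
        f = h + ∑ j, MvPowerSeries.X j ^ N * g j ∧
        ∀ m, coeff m h ≠ 0 → ∀ j ∈ S, m j < N := by
    intro S
    induction S using Finset.induction_on with
    | empty => exact fun f => ⟨f, 0, by simp, by simp⟩
    | insert j S hj ih =>
      intro f
      obtain ⟨h, g, hf, hS⟩ := ih f
      -- Split `h` by the exponent of `X j`: the terms with exponent at least `N` form `X j ^ N *
      -- hi`.
      let lo : MvPowerSeries (Fin n) K := fun m => if m j < N then coeff m h else 0
      let hi : MvPowerSeries (Fin n) K := fun m => coeff (m + Finsupp.single j N) h
      have hlo : ∀ m, coeff m lo = if m j < N then coeff m h else 0 := fun m => rfl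
      have hhi : ∀ m, coeff m hi = coeff (m + Finsupp.single j N) h := fun m => rfl
      have hh : h = lo + MvPowerSeries.X j ^ N * hi := by
        ext m
        rw [map_add, hlo, X_pow_eq, coeff_monomial_mul, hhi]
        by_cases hm : m j < N
        · have : ¬ Finsupp.single j N ≤ m := by
            rw [Finsupp.single_le_iff]; omega
          simp [hm, this]
        · have h3 : Finsupp.single j N ≤ m := by
            rw [Finsupp.single_le_iff]; omega
          simp [hm, h3, tsub_add_cancel_of_le h3]
      refine ⟨lo, g + Pi.single j hi, ?_, ?_⟩
      · simp only [Pi.add_apply, mul_add, Finset.sum_add_distrib]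
        have hs : ∑ x, MvPowerSeries.X x ^ N *
            (Pi.single j hi : Fin n → MvPowerSeries (Fin n) K) x = MvPowerSeries.X j ^ N * hi := by
          rw [Finset.sum_eq_single j (fun b _ hb => by rw [Pi.single_eq_of_ne hb, mul_zero])
            (by simp), Pi.single_eq_same]
        rw [hs, hf]
        conv_lhs => rw [hh]
        abel
      · intro m hm i hi
        rw [hlo] at hm
        rcases Finset.mem_insert.mp hi with rfl | hi
        · by_contra hc; simp [hc] at hm
        · refine hS m (fun h0 => hm (by simp [h0])) i hi
  obtain ⟨h, g, hf, hS⟩ := step Finset.univ f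
  refine ⟨fun a => coeff (Finsupp.equivFunOnFinite.symm fun j => (a j : ℕ)) h, g, ?_⟩
  rw [hf]
  congr 1
  ext m
  rw [map_sum]
  simp only [coeff_monomial]
  by_cases hm : coeff m h = 0
  · rw [hm, Finset.sum_eq_zero]
    intro a _
    split_ifs with h1
    · rw [← h1, hm]
    · rfl
  · have hlt := hS m hm
    rw [Finset.sum_eq_single (fun j => (⟨m j, hlt j (Finset.mem_univ j)⟩ : Fin N))]
    · have : (Finsupp.equivFunOnFinite.symm fun j => m j) = m := by ext; simp
      simp [this]
    · intro a _ ha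
      rw [if_neg]
      intro h1
      apply ha
      ext j
      simp [h1]
    · simp

/-- An element that is divisible by all powers of a nonzero nonunit `t` and divides one of them, if it
is nonzero, is zero. -/
theorem eq_zero_of_forall_pow_dvd {S : Type*} [CommRing S] [IsDomain S] {t z : S} (ht : t ≠ 0)
    (ht' : ¬ IsUnit t) (hz : z ≠ 0 → ∃ M, z ∣ t ^ M) (h : ∀ N : ℕ, t ^ N ∣ z) : z = 0 := by
  by_contra hz0
  obtain ⟨M, hM⟩ := hz hz0
  -- `t ^ (M + 1) ∣ z ∣ t ^ M` would make `t` a unit.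
  obtain ⟨u, hu⟩ := (h (M + 1)).trans hM
  apply ht'
  have : t ^ M * 1 = t ^ M * (t * u) := by rw [mul_one, ← mul_assoc, ← pow_succ, ← hu]
  exact IsUnit.of_mul_eq_one _ (mul_left_cancel₀ (pow_ne_zero _ ht) this).symm

open PowerSeries in
/-- A family of elements of a `K⟦X⟧`-algebra that is `K`-linearly independent modulo `X` is
`K⟦X⟧`-linearly independent. -/
theorem PowerSeries.linearIndependent_of_mod_X {K V ι : Type*} [Field K] [CommRing V] [IsDomain V]
    [Algebra K⟦X⟧ V] [Fintype ι] (ht : algebraMap K⟦X⟧ V X ≠ 0) (y : ι → V)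
    (hy : ∀ c : ι → K, algebraMap K⟦X⟧ V X ∣ ∑ i, (C (c i) : K⟦X⟧) • y i → c = 0) :
    LinearIndependent K⟦X⟧ y := by
  rw [Fintype.linearIndependent_iff]
  intro f hf
  -- Cancel `X ^ N` from the relation; the constant terms of the quotients then form a relation
  -- modulo `X`, so they vanish.
  have key : ∀ N : ℕ, ∀ i, (X : K⟦X⟧) ^ N ∣ f i := by
    intro N
    induction N with
    | zero => simp
    | succ N ih =>
      choose g hg using ih
      have h0 : ∑ i, g i • y i = 0 := by
        have : algebraMap K⟦X⟧ V X ^ N * ∑ i, g i • y i = 0 := by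
          rw [← hf, Finset.mul_sum]
          refine Finset.sum_congr rfl fun i _ => ?_
          rw [hg i, mul_smul, ← map_pow, ← Algebra.smul_def]
        exact (mul_eq_zero.mp this).resolve_left (pow_ne_zero _ ht)
      have hc := hy (fun i => constantCoeff (g i)) ?_
      · intro i
        rw [hg i, pow_succ]
        exact mul_dvd_mul_left _ (X_dvd_iff.mpr (congrFun hc i))
      · refine ⟨- ∑ i, (PowerSeries.mk fun p => coeff (p + 1) (g i)) • y i, ?_⟩
        have h1 : ∀ i, g i • y i =
            algebraMap K⟦X⟧ V X * (PowerSeries.mk fun p => coeff (p + 1) (g i)) • y i +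
            (C (constantCoeff (g i)) : K⟦X⟧) • y i := by
          intro i
          conv_lhs => rw [eq_X_mul_shift_add_const (g i), add_smul, mul_smul,
            Algebra.smul_def X]
        rw [Finset.sum_congr rfl fun i _ => h1 i, Finset.sum_add_distrib, ← Finset.mul_sum] at h0
        rw [mul_neg]
        exact eq_neg_of_add_eq_zero_right h0
  intro i
  ext k
  exact X_pow_dvd_iff.mp (key (k + 1) i) k (Nat.lt_succ_self k)

open PowerSeries in
/-- If the number of elements that are linearly independent modulo `X` is bounded, then a finite
family generates modulo `X`. -/
theorem PowerSeries.exists_generators_mod_X {K V : Type*} [Field K] [CommRing V]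
    [Algebra K⟦X⟧ V] (B : ℕ)
    (hB : ∀ (s : ℕ) (y : Fin s → V),
      (∀ c : Fin s → K, algebraMap K⟦X⟧ V X ∣ ∑ i, (C (c i) : K⟦X⟧) • y i → c = 0) → s ≤ B) :
    ∃ (s : ℕ) (y : Fin s → V), ∀ x : V, ∃ (c : Fin s → K) (x' : V),
      x = ∑ i, (C (c i) : K⟦X⟧) • y i + (X : K⟦X⟧) • x' := by
  classical
  let P : ℕ → Prop := fun s => ∃ y : Fin s → V,
    ∀ c : Fin s → K, algebraMap K⟦X⟧ V X ∣ ∑ i, (C (c i) : K⟦X⟧) • y i → c = 0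
  have hP0 : P 0 := ⟨Fin.elim0, fun c _ => Subsingleton.elim _ _⟩
  -- For an independent family of maximal length, adjoining any `x` creates a relation modulo `X`,
  -- in which `x` has nonzero coefficient.
  obtain ⟨s, hs⟩ : ∃ s, s = Nat.findGreatest P B := ⟨_, rfl⟩
  obtain ⟨y, hy⟩ : P s := hs ▸ Nat.findGreatest_spec (Nat.zero_le _) hP0
  refine ⟨s, y, fun x => ?_⟩
  have hnot : ¬ P (s + 1) := fun h => by
    have h1 := Nat.le_findGreatest (P := P) (hB _ _ h.choose_spec) h
    omega
  have h1 : ∃ c : Fin (s + 1) → K, algebraMap K⟦X⟧ V X ∣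
      ∑ i, (C (c i) : K⟦X⟧) • (Fin.cons x y : Fin (s + 1) → V) i ∧ c ≠ 0 := by
    by_contra hcon
    push Not at hcon
    exact hnot ⟨Fin.cons x y, hcon⟩
  obtain ⟨c, hdvd, hc⟩ := h1
  obtain ⟨w, hw⟩ := hdvd
  rw [Fin.sum_univ_succ] at hw
  simp only [Fin.cons_zero, Fin.cons_succ] at hw
  have hc0 : c 0 ≠ 0 := by
    intro h0
    apply hc
    have := hy (fun i => c i.succ) ⟨w, by simpa [h0] using hw⟩
    ext i
    refine Fin.cases h0 (fun j => congrFun this j) i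
  refine ⟨fun i => - ((c 0)⁻¹ * c i.succ), (C (c 0)⁻¹ : K⟦X⟧) • w, ?_⟩
  have h2 : x = (C (c 0)⁻¹ : K⟦X⟧) • ((C (c 0) : K⟦X⟧) • x) := by
    rw [smul_smul, ← map_mul, inv_mul_cancel₀ hc0, map_one, one_smul]
  rw [h2, eq_sub_of_add_eq hw, smul_sub, Finset.smul_sum, ← Algebra.smul_def, smul_comm X,
    sub_eq_add_neg, add_comm, ← Finset.sum_neg_distrib]
  congr 1
  refine Finset.sum_congr rfl fun i _ => ?_
  rw [map_neg, neg_smul, map_mul, mul_smul]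

/-- If `V` is a `K⟦X⟧`-algebra, finite as a module, and local, with `K` algebraically closed, then
every element of `V` differs from a constant by a nonunit. -/
theorem PowerSeries.exists_not_isUnit_sub_C {K V : Type*} [Field K] [IsAlgClosed K] [CommRing V]
    [IsLocalRing V] [Algebra (PowerSeries K) V] [Module.Finite (PowerSeries K) V]
    (ht : ¬ IsUnit (algebraMap (PowerSeries K) V PowerSeries.X)) (b : V) :
    ∃ c : K, ¬ IsUnit (b - algebraMap (PowerSeries K) V (PowerSeries.C c)) := by
  let ρ : PowerSeries K →+* IsLocalRing.ResidueField V :=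
    (IsLocalRing.residue V).comp (algebraMap (PowerSeries K) V)
  let f : K →+* IsLocalRing.ResidueField V := ρ.comp PowerSeries.C
  -- `X` dies in the residue field, so integrality over `K⟦X⟧` descends to integrality over the
  -- algebraically closed field `K`.
  have hρ : ρ = f.comp PowerSeries.constantCoeff := by
    ext x
    have h1 : ρ PowerSeries.X = 0 := (IsLocalRing.residue_eq_zero_iff _).mpr ht
    conv_lhs => rw [PowerSeries.eq_X_mul_shift_add_const x]
    rw [map_add, map_mul, h1, zero_mul, zero_add]
    rfl
  have hf : f.IsIntegral := by
    intro z
    obtain ⟨z, rfl⟩ := IsLocalRing.residue_surjective z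
    obtain ⟨p, hp, hz⟩ := Algebra.IsIntegral.isIntegral (R := PowerSeries K) z
    refine ⟨p.map PowerSeries.constantCoeff, hp.map _, ?_⟩
    rw [Polynomial.eval₂_map, ← hρ, ← Polynomial.hom_eval₂, hz, map_zero]
  obtain ⟨c, hc⟩ := (IsAlgClosed.ringHom_bijective_of_isIntegral f hf).2 (IsLocalRing.residue V b)
  refine ⟨c, ?_⟩
  rw [← mem_nonunits_iff, ← IsLocalRing.mem_maximalIdeal, ← IsLocalRing.residue_eq_zero_iff,
    map_sub, sub_eq_zero, ← hc]
  rfl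

/-! ### Normalization of a branch -/

/-- Let `A` be a one-dimensional local domain that is finite over `K⟦X⟧` (`K` algebraically closed).
Its normalization is a discrete valuation ring with residue field `K` and has a nonzero conductor. -/
theorem integralClosure_isDiscreteValuationRing_of_finite_powerSeries
    {K A L : Type*} [Field K] [IsAlgClosed K]
    [CommRing A] [IsDomain A] [IsLocalRing A] [Algebra (PowerSeries K) A]
    [Module.Finite (PowerSeries K) A] [Field L] [Algebra A L] [IsFractionRing A L]
    (ht : algebraMap (PowerSeries K) A PowerSeries.X ≠ 0)
    (htu : ¬ IsUnit (algebraMap (PowerSeries K) A PowerSeries.X))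
    (hdvd : ∀ a : A, a ≠ 0 → ∃ N : ℕ, a ∣ algebraMap (PowerSeries K) A PowerSeries.X ^ N) :
    IsDiscreteValuationRing (integralClosure A L) ∧
    (∀ b : integralClosure A L, ∃ c : K, ¬ IsUnit (b - algebraMap A (integralClosure A L)
      (algebraMap (PowerSeries K) A (PowerSeries.C c)))) ∧
    ∃ d : A, d ≠ 0 ∧ ∀ b : integralClosure A L, ∃ a : A,
      algebraMap A (integralClosure A L) d * b = algebraMap A (integralClosure A L) a := by
  -- `V` is a valuation ring of `L` dominating `A`; it turns out to be the normalization.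
  obtain ⟨V, hV, hloc⟩ := IsLocalRing.exists_factor_valuationRing (algebraMap A L)
  let j : A →+* V := (algebraMap A L).codRestrict V.toSubring hV
  let _ : Algebra A V := j.toAlgebra
  let _ : Algebra (PowerSeries K) V := (j.comp (algebraMap (PowerSeries K) A)).toAlgebra
  let _ : Algebra (PowerSeries K) L :=
    ((algebraMap A L).comp (algebraMap (PowerSeries K) A)).toAlgebra
  have : IsScalarTower (PowerSeries K) A L := IsScalarTower.of_algebraMap_eq fun _ => rfl
  have : IsScalarTower (PowerSeries K) A V := IsScalarTower.of_algebraMap_eq fun _ => rfl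
  have : IsScalarTower (PowerSeries K) V L := IsScalarTower.of_algebraMap_eq fun _ => rfl
  have : IsScalarTower A V L := IsScalarTower.of_algebraMap_eq fun _ => rfl
  have hjinj : Function.Injective j := fun a b h =>
    IsFractionRing.injective A L (congrArg (Subtype.val : V → L) h)
  have htV : algebraMap (PowerSeries K) V PowerSeries.X ≠ 0 := fun h =>
    ht (hjinj (by rw [map_zero]; exact h))
  have htuV : ¬ IsUnit (algebraMap (PowerSeries K) V PowerSeries.X) := fun h => htu (hloc.1 _ h)
  -- Writing `z = a / b`, `z` divides `a`, which divides a power of `X`.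
  have hdvdV : ∀ z : V, z ≠ 0 → ∃ N : ℕ, z ∣ algebraMap (PowerSeries K) V PowerSeries.X ^ N := by
    intro z hz
    obtain ⟨a, b, hb, hab⟩ := IsFractionRing.div_surjective (A := A) (z : L)
    have hb0 : algebraMap A L b ≠ 0 := by
      rw [Ne, IsFractionRing.to_map_eq_zero_iff]
      exact nonZeroDivisors.ne_zero hb
    have hzb : z * j b = j a := Subtype.ext (by
      change (z : L) * algebraMap A L b = algebraMap A L a
      rw [← hab, div_mul_cancel₀ _ hb0])
    have ha : a ≠ 0 := by
      rintro rfl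
      rw [map_zero, zero_div] at hab
      exact hz (Subtype.ext hab.symm)
    obtain ⟨N, c, hc⟩ := hdvd a ha
    refine ⟨N, j b * j c, ?_⟩
    rw [← mul_assoc, hzb, ← map_mul, ← hc, map_pow]
    rfl
  -- Clearing denominators moves a family independent modulo `X` into `A`, whose rank bounds its
  -- length.
  have hB : ∀ (s : ℕ) (y : Fin s → V), (∀ c : Fin s → K, algebraMap (PowerSeries K) V PowerSeries.X ∣
      ∑ i, (PowerSeries.C (c i) : PowerSeries K) • y i → c = 0) →
      s ≤ Module.finrank (PowerSeries K) A := by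
    intro s y hy
    have hlin := PowerSeries.linearIndependent_of_mod_X htV y hy
    obtain ⟨d, hd⟩ := IsLocalization.exist_integer_multiples_of_finite (nonZeroDivisors A)
      (fun i => (y i : L))
    choose a ha using hd
    have hd0 : j d ≠ 0 := fun h =>
      nonZeroDivisors.ne_zero d.2 (hjinj (h.trans (map_zero j).symm))
    have haj : ∀ i, j (a i) = j d * y i := fun i => Subtype.ext (by
      change algebraMap A L (a i) = algebraMap A L d * (y i : L)
      rw [ha i, Algebra.smul_def])
    have hlina : LinearIndependent (PowerSeries K) a := by
      rw [Fintype.linearIndependent_iff] at hlin ⊢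
      intro g hg
      refine hlin g ?_
      have h1 : j d * ∑ i, g i • y i = 0 := by
        rw [← map_zero j, ← hg, map_sum, Finset.mul_sum]
        refine Finset.sum_congr rfl fun i _ => ?_
        rw [Algebra.smul_def, Algebra.smul_def, map_mul, haj i, mul_left_comm]
        rfl
      exact (mul_eq_zero.mp h1).resolve_left hd0
    simpa using hlina.fintype_card_le_finrank
  obtain ⟨s, y, hy⟩ := PowerSeries.exists_generators_mod_X _ hB
  have hspan := PowerSeries.span_range_eq_top_of_separated y (fun z hz => by
    refine eq_zero_of_forall_pow_dvd htV htuV (hdvdV z) fun N => ?_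
    obtain ⟨w, hw⟩ := hz N
    exact ⟨w, by rw [hw, Algebra.smul_def, map_pow]⟩) hy
  have : Module.Finite (PowerSeries K) V :=
    ⟨Submodule.fg_def.mpr ⟨_, Set.finite_range y, hspan⟩⟩
  have : IsNoetherianRing V := isNoetherian_of_tower (PowerSeries K) inferInstance
  have hfield : ¬ IsField V := fun h => htuV (by
    obtain ⟨u, hu⟩ := h.mul_inv_cancel htV
    exact IsUnit.of_mul_eq_one _ hu)
  have hiff : IsDiscreteValuationRing V ↔ ValuationRing V :=
    (IsDiscreteValuationRing.TFAE V hfield).out 0 1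
  have : IsDiscreteValuationRing V := hiff.mpr inferInstance
  -- One inclusion holds because `V` is integrally closed, the other because `V` is finite over
  -- `K⟦X⟧`.
  have hmem : ∀ x : L, x ∈ integralClosure A L ↔ x ∈ V := by
    intro x
    refine ⟨fun hx => ?_, fun hx => ?_⟩
    · have h1 : IsIntegral V x := IsIntegral.tower_top (R := A) hx
      obtain ⟨z, hz⟩ := IsIntegrallyClosed.isIntegral_iff.mp h1
      rw [← hz]
      exact z.2
    · have h1 : IsIntegral (PowerSeries K) (⟨x, hx⟩ : V) := Algebra.IsIntegral.isIntegral _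
      have h2 : IsIntegral (PowerSeries K) x := h1.algebraMap (B := L)
      exact IsIntegral.tower_top (R := PowerSeries K) h2
  let e : integralClosure A L ≃+* V :=
    { toFun := fun x => ⟨x, (hmem _).mp x.2⟩
      invFun := fun x => ⟨x, (hmem _).mpr x.2⟩
      left_inv := fun _ => rfl
      right_inv := fun _ => rfl
      map_mul' := fun _ _ => rfl
      map_add' := fun _ _ => rfl }
  refine ⟨IsDiscreteValuationRing.RingEquivClass.isDiscreteValuationRing e.symm, fun b => ?_, ?_⟩
  · obtain ⟨c, hc⟩ := PowerSeries.exists_not_isUnit_sub_C htuV (e b)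
    refine ⟨c, fun h => hc ?_⟩
    have h2 := h.map e
    rw [map_sub] at h2
    exact h2
  -- A common denominator of the generators `y` lies in the conductor.
  · obtain ⟨d, hd⟩ := IsLocalization.exist_integer_multiples_of_finite (nonZeroDivisors A)
      (fun i => (y i : L))
    choose a ha using hd
    refine ⟨d, nonZeroDivisors.ne_zero d.2, fun b => ?_⟩
    obtain ⟨g, hg⟩ := (Submodule.mem_span_range_iff_exists_fun _).mp
      (hspan ▸ Submodule.mem_top : e b ∈ Submodule.span (PowerSeries K) (Set.range y))
    refine ⟨∑ i, g i • a i, Subtype.ext ?_⟩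
    have h1 : (b : L) = ∑ i, g i • (y i : L) := by
      change ((e b : V) : L) = _
      rw [← hg]
      simp [Algebra.smul_def]
      rfl
    change algebraMap A L d * (b : L) = algebraMap A L _
    rw [h1, map_sum, Finset.mul_sum]
    refine Finset.sum_congr rfl fun i _ => ?_
    rw [Algebra.smul_def, Algebra.smul_def, map_mul, ha i, Algebra.smul_def, mul_left_comm]
    rfl

/-- In a one-dimensional local domain every nonzero element divides a power of any nonunit. -/
theorem dvd_pow_of_krullDim_eq_one {A : Type*} [CommRing A] [IsDomain A] [IsLocalRing A]
    (h : ringKrullDim A = 1) {a t : A} (ha : a ≠ 0) (ht : ¬ IsUnit t) : ∃ N : ℕ, a ∣ t ^ N := by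
  have : Ring.KrullDimLE 1 A := Ring.krullDimLE_iff.mpr h.le
  -- A prime containing `a` is nonzero, hence maximal, hence contains `t`.
  have h1 : t ∈ (Ideal.span {a}).radical := by
    rw [Ideal.radical_eq_sInf, Submodule.mem_sInf]
    rintro p ⟨hp, hprime⟩
    have hpb : p ≠ ⊥ := by
      rintro rfl
      exact ha (by simpa using hp)
    have := hprime
    have := hprime.isMaximal_of_ne_bot hpb
    rw [IsLocalRing.eq_maximalIdeal this]
    exact ht
  obtain ⟨N, hN⟩ := h1
  exact ⟨N, Ideal.mem_span_singleton.mp hN⟩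

/-- The normalization of a one-dimensional quotient domain of `K⟦X₁, …, Xₙ⟧`, with `K` algebraically
closed, is a discrete valuation ring with residue field `K` and has a nonzero conductor. -/
theorem MvPowerSeries.integralClosure_quotient_isDiscreteValuationRing
    {K : Type*} [Field K] [IsAlgClosed K] {n : ℕ} (P : Ideal (MvPowerSeries (Fin n) K)) [P.IsPrime]
    (hdim : ringKrullDim (MvPowerSeries (Fin n) K ⧸ P) = 1)
    (L : Type*) [Field L] [Algebra (MvPowerSeries (Fin n) K ⧸ P) L]
    [IsFractionRing (MvPowerSeries (Fin n) K ⧸ P) L] :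
    IsDiscreteValuationRing (integralClosure (MvPowerSeries (Fin n) K ⧸ P) L) ∧
    (∀ b : integralClosure (MvPowerSeries (Fin n) K ⧸ P) L, ∃ c : K,
      ¬ IsUnit (b - algebraMap (MvPowerSeries (Fin n) K ⧸ P) _
        (algebraMap K (MvPowerSeries (Fin n) K ⧸ P) c))) ∧
    ∃ d : MvPowerSeries (Fin n) K ⧸ P, d ≠ 0 ∧
      ∀ b : integralClosure (MvPowerSeries (Fin n) K ⧸ P) L, ∃ a : MvPowerSeries (Fin n) K ⧸ P,
        algebraMap _ (integralClosure (MvPowerSeries (Fin n) K ⧸ P) L) d * b =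
          algebraMap _ (integralClosure (MvPowerSeries (Fin n) K ⧸ P) L) a := by
  set A := MvPowerSeries (Fin n) K ⧸ P with hA
  have : IsLocalRing A :=
    IsLocalRing.of_surjective' (Ideal.Quotient.mk P) Ideal.Quotient.mk_surjective
  have hnf : ¬ IsField A := fun hf => by
    rw [ringKrullDim_eq_zero_of_isField hf] at hdim
    exact zero_ne_one hdim
  obtain ⟨t, ht, htu⟩ : ∃ t : A, t ≠ 0 ∧ ¬ IsUnit t := by
    obtain ⟨t, ht, ht'⟩ := Submodule.exists_mem_ne_zero_of_ne_bot
      (fun h => hnf (IsLocalRing.isField_iff_maximalIdeal_eq.mpr h))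
    exact ⟨t, ht', ht⟩
  -- Substituting a lift of the parameter `t` for `X` makes `A` a `K⟦X⟧`-algebra; the lift has zero
  -- constant term because `t` is a nonunit.
  obtain ⟨τ, rfl⟩ := Ideal.Quotient.mk_surjective t
  have hτ : MvPowerSeries.constantCoeff τ = 0 := by
    by_contra h
    exact htu ((MvPowerSeries.isUnit_iff_constantCoeff.mpr (isUnit_iff_ne_zero.mpr h)).map _)
  have hs : PowerSeries.HasSubst τ := PowerSeries.HasSubst.of_constantCoeff_zero hτ
  let φ : PowerSeries K →ₐ[K] A := (Ideal.Quotient.mkₐ K P).comp (PowerSeries.substAlgHom hs)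
  let _ : Algebra (PowerSeries K) A := φ.toRingHom.toAlgebra
  have hφX : algebraMap (PowerSeries K) A PowerSeries.X = Ideal.Quotient.mk P τ := by
    change Ideal.Quotient.mk P (PowerSeries.substAlgHom hs PowerSeries.X) = _
    rw [PowerSeries.substAlgHom_X]
  have hφC : ∀ c : K, algebraMap (PowerSeries K) A (PowerSeries.C c) = algebraMap K A c :=
    fun c => φ.commutes c
  have hdvd : ∀ a : A, a ≠ 0 → ∃ N : ℕ, a ∣ algebraMap (PowerSeries K) A PowerSeries.X ^ N :=
    fun a ha => dvd_pow_of_krullDim_eq_one hdim ha (hφX ▸ htu)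
  -- Since `t` divides the `N`-th power of every variable, the monomials with exponents below `N`
  -- generate `A` modulo `t`.
  have hXdvd : ∃ N : ℕ, ∀ j : Fin n,
      Ideal.Quotient.mk P τ ∣ Ideal.Quotient.mk P (MvPowerSeries.X j) ^ N := by
    have h1 : ∀ j : Fin n, ∃ N : ℕ,
        Ideal.Quotient.mk P τ ∣ Ideal.Quotient.mk P (MvPowerSeries.X j) ^ N := by
      intro j
      refine dvd_pow_of_krullDim_eq_one hdim ht fun hu => ?_
      have hloc : IsLocalHom (Ideal.Quotient.mk P) :=
        .of_surjective _ Ideal.Quotient.mk_surjective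
      have := MvPowerSeries.isUnit_iff_constantCoeff.mp (hloc.map_nonunit _ hu)
      simp at this
    choose N hN using h1
    exact ⟨Finset.univ.sup N, fun j =>
      (hN j).trans (pow_dvd_pow _ (Finset.le_sup (Finset.mem_univ j)))⟩
  obtain ⟨N, hN⟩ := hXdvd
  have hspan := PowerSeries.span_range_eq_top_of_separated (K := K) (M := A)
    (fun a : Fin n → Fin N => Ideal.Quotient.mk P
      (MvPowerSeries.monomial (Finsupp.equivFunOnFinite.symm fun j => (a j : ℕ)) 1))
    (fun z hz => by
      refine eq_zero_of_forall_pow_dvd (t := algebraMap (PowerSeries K) A PowerSeries.X)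
        (hφX ▸ ht) (hφX ▸ htu) (hdvd z) fun N => ?_
      obtain ⟨w, hw⟩ := hz N
      exact ⟨w, by rw [hw, Algebra.smul_def, map_pow]⟩)
    (fun x => by
      obtain ⟨f, rfl⟩ := Ideal.Quotient.mk_surjective x
      obtain ⟨c, g, hfg⟩ := MvPowerSeries.exists_eq_sum_monomial_add_sum_X_pow_mul N f
      choose w hw using hN
      refine ⟨c, ∑ j, w j * Ideal.Quotient.mk P (g j), ?_⟩
      conv_lhs => rw [hfg]
      rw [map_add, map_sum, map_sum]
      congr 1
      · refine Finset.sum_congr rfl fun a _ => ?_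
        rw [Algebra.smul_def, hφC, ← mul_one (c a), ← smul_eq_mul (c a) 1,
          LinearMap.map_smul, Algebra.smul_def, map_mul, smul_eq_mul, mul_one]
        rfl
      · rw [Algebra.smul_def, hφX, Finset.mul_sum]
        refine Finset.sum_congr rfl fun j _ => ?_
        rw [map_mul, map_pow, hw j, mul_assoc])
  have : Module.Finite (PowerSeries K) A :=
    ⟨Submodule.fg_def.mpr ⟨_, Set.finite_range _, hspan⟩⟩
  obtain ⟨h1, h2, h3⟩ := integralClosure_isDiscreteValuationRing_of_finite_powerSeries
    (K := K) (A := A) (L := L) (hφX ▸ ht) (hφX ▸ htu) hdvd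
  refine ⟨h1, fun b => ?_, h3⟩
  obtain ⟨c, hc⟩ := h2 b
  exact ⟨c, by rwa [hφC] at hc⟩

/-! ### Branches and value vectors -/

namespace AlgebroidCurve

variable {K : Type*} [Field K] {n : ℕ} (C : AlgebroidCurve K n)

instance (i : C.Branch) : i.1.IsPrime := i.2.1.1

/-- The map from the ring of the curve to the normalization of a branch. -/
def toNormalization (i : C.Branch) : C.CoordRing →+* C.BranchNormalization i :=
  (algebraMap (C.BranchRing i) (C.BranchNormalization i)).comp (C.toBranch i)

theorem toBranch_surjective (i : C.Branch) : Function.Surjective (C.toBranch i) :=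
  Ideal.Quotient.factor_surjective _

theorem toNormalization_eq_zero_iff (i : C.Branch) (g : C.CoordRing) :
    C.toNormalization i g = 0 ↔ C.toBranch i g = 0 := by
  have h : Function.Injective (algebraMap (C.BranchRing i) (C.BranchNormalization i)) :=
    fun a b hab => IsFractionRing.injective (C.BranchRing i) (FractionRing (C.BranchRing i))
      (congrArg Subtype.val hab)
  exact map_eq_zero_iff _ h

/-- A radical ideal is the intersection of its minimal primes. -/
theorem eq_zero_of_forall_toBranch {g : C.CoordRing} (h : ∀ i, C.toBranch i g = 0) : g = 0 := by
  obtain ⟨f, rfl⟩ := Ideal.Quotient.mk_surjective g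
  rw [Ideal.Quotient.eq_zero_iff_mem, ← C.isRadical.radical, ← Ideal.sInf_minimalPrimes,
    Submodule.mem_sInf]
  exact fun P hP => Ideal.Quotient.eq_zero_iff_mem.mp (h ⟨P, hP⟩)

/-- On each branch, some element vanishes on all other branches but not on the given one. -/
theorem exists_toBranch_ne_zero [Finite C.Branch] (i : C.Branch) :
    ∃ e : C.CoordRing, C.toBranch i e ≠ 0 ∧ ∀ j, j ≠ i → C.toBranch j e = 0 := by
  classical
  have := Fintype.ofFinite C.Branch
  -- Distinct minimal primes are incomparable. The choice at `j = i` is a dummy, left out of the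
  -- product below.
  have h1 : ∀ j : C.Branch, ∃ f : MvPowerSeries (Fin n) K, j ≠ i → f ∈ j.1 ∧ f ∉ i.1 := by
    intro j
    by_cases hj : j = i
    · exact ⟨0, fun h => absurd hj h⟩
    · have : ¬ j.1 ≤ i.1 := fun hle =>
        hj (Subtype.ext (le_antisymm hle (i.2.2 j.2.1 hle)))
      obtain ⟨f, hf, hf'⟩ := SetLike.not_le_iff_exists.mp this
      exact ⟨f, fun _ => ⟨hf, hf'⟩⟩
  choose f hf using h1
  refine ⟨Ideal.Quotient.mk _ (∏ j ∈ Finset.univ.erase i, f j), ?_, fun j hj => ?_⟩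
  · change Ideal.Quotient.mk i.1 _ ≠ 0
    rw [Ne, Ideal.Quotient.eq_zero_iff_mem, Ideal.IsPrime.prod_mem_iff]
    rintro ⟨j, hj, hji⟩
    exact (hf j (Finset.ne_of_mem_erase hj)).2 hji
  · change Ideal.Quotient.mk j.1 _ = 0
    rw [Ideal.Quotient.eq_zero_iff_mem]
    exact Ideal.mem_of_dvd _ (Finset.dvd_prod_of_mem f (Finset.mem_erase.mpr ⟨hj, Finset.mem_univ _⟩))
      (hf j hj).1

/-- An absolute point has no strictly greater value with a common finite component. -/
theorem IsAbsolutePoint.value_eq {γ : C.Branch → ℕ∞} (hγ : C.IsAbsolutePoint γ) {p : C.CoordRing}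
    {k : C.Branch} (hk : γ k ≠ ⊤) (hle : γ ≤ C.value p) (heq : C.value p k = γ k) :
    C.value p = γ := by
  by_contra hne
  -- `J` is where `v(p)` and `γ` agree and are finite. It contains `k`; if it were proper, `v(p)`
  -- would lie in `F_J(γ)`.
  let J : Set C.Branch := {i | γ i ≠ ⊤ ∧ C.value p i = γ i}
  have hJsub : J ⊆ C.finiteSupport γ := fun i hi => hi.1
  have hoff : ∀ i, i ∉ C.finiteSupport γ \ J → C.value p i = γ i := by
    intro i hi
    by_cases hit : γ i = ⊤
    · rw [hit]
      exact top_le_iff.mp (hit ▸ hle i)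
    · by_contra h
      exact hi ⟨hit, fun hJ => h hJ.2⟩
  have hss : J ⊂ C.finiteSupport γ := by
    refine ⟨hJsub, fun hsub => hne (funext fun i => hoff i fun hi => hi.2 (hsub hi.1))⟩
  have hempty := hγ.2 J ⟨k, hk, heq⟩ hss
  refine Set.eq_empty_iff_forall_notMem.mp hempty (C.value p) ⟨⟨p, rfl⟩, fun i hi => ?_, hoff⟩
  exact lt_of_le_of_ne (hle i) fun h => hi.2 ⟨hi.1, h.symm⟩

variable [IsAlgClosed K]

instance (i : C.Branch) : IsDiscreteValuationRing (C.BranchNormalization i) :=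
  (MvPowerSeries.integralClosure_quotient_isDiscreteValuationRing i.1
    (C.krullDim_eq_one i.1 i.2) _).1

theorem value_apply (g : C.CoordRing) (i : C.Branch) :
    C.value g i = IsDiscreteValuationRing.addVal _ (C.toNormalization i g) :=
  radicalOrder_eq_addVal _ _

theorem value_eq_top_iff {g : C.CoordRing} {i : C.Branch} :
    C.value g i = ⊤ ↔ C.toBranch i g = 0 := by
  rw [value_apply, IsDiscreteValuationRing.addVal_eq_top_iff, toNormalization_eq_zero_iff]

theorem value_eq_top_iff_eq_zero {g : C.CoordRing} : C.value g = ⊤ ↔ g = 0 := by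
  refine ⟨fun h => C.eq_zero_of_forall_toBranch fun i =>
    C.value_eq_top_iff.mp (congrFun h i), fun h => ?_⟩
  ext i
  rw [h, C.value_eq_top_iff.mpr (map_zero _), Pi.top_apply]

theorem value_mul (g h : C.CoordRing) : C.value (g * h) = C.value g + C.value h := by
  ext i
  simp only [value_apply, Pi.add_apply, map_mul, IsDiscreteValuationRing.addVal_mul]

theorem value_one : C.value 1 = 0 := by
  ext i
  simp only [value_apply, map_one, IsDiscreteValuationRing.addVal_one, Pi.zero_apply]

theorem min_le_value_sub (g h : C.CoordRing) (i : C.Branch) :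
    min (C.value g i) (C.value h i) ≤ C.value (g - h) i := by
  simp only [value_apply, map_sub]
  exact AddValuation.map_sub _ _ _

theorem value_sub_eq_of_lt_left {g h : C.CoordRing} {i : C.Branch}
    (hgh : C.value g i < C.value h i) : C.value (g - h) i = C.value g i := by
  simp only [value_apply, map_sub] at *
  exact AddValuation.map_sub_eq_of_lt_left _ hgh

theorem value_eq_zero_of_isUnit {g : C.CoordRing} (hg : IsUnit g) : C.value g = 0 := by
  ext i
  rw [value_apply, Pi.zero_apply, IsDiscreteValuationRing.addVal_eq_zero_iff]
  exact hg.map _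

/-- Both maps to the normalization reflect units: the first is a surjection from a local ring, the
second an injective integral extension. -/
theorem value_pos_of_mem_maxIdeal {g : C.CoordRing} (hg : g ∈ C.maxIdeal) (i : C.Branch) :
    0 < C.value g i := by
  rw [pos_iff_ne_zero, value_apply, Ne, IsDiscreteValuationRing.addVal_eq_zero_iff]
  intro hu
  have h1 : IsUnit (C.toBranch i g) := by
    have : IsLocalHom (algebraMap (C.BranchRing i) (C.BranchNormalization i)) := inferInstance
    exact this.map_nonunit _ hu
  have : IsLocalHom (C.toBranch i) := .of_surjective _ (C.toBranch_surjective i)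
  exact hg (this.map_nonunit _ h1)

theorem value_algebraMap_mul {c : K} (hc : c ≠ 0) (g : C.CoordRing) :
    C.value (algebraMap K C.CoordRing c * g) = C.value g := by
  rw [value_mul, C.value_eq_zero_of_isUnit ((isUnit_iff_ne_zero.mpr hc).map _), zero_add]

/-- Two elements with the same finite value on a branch have, up to a nonzero constant, the same
initial form there. -/
theorem exists_value_lt_value_sub {g h : C.CoordRing} {i : C.Branch}
    (hg : C.value g i ≠ ⊤) (hgh : C.value g i = C.value h i) :
    ∃ c : K, c ≠ 0 ∧ C.value g i < C.value (g - algebraMap K C.CoordRing c * h) i := by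
  have hassoc : Associated (C.toNormalization i h) (C.toNormalization i g) := by
    rw [← IsDiscreteValuationRing.addVal_eq_iff_associated, ← value_apply, ← value_apply, hgh]
  obtain ⟨u, hu⟩ := hassoc
  -- `c` is the residue of the unit `u = g / h`, so `g - c h = h (u - c)` has larger value.
  obtain ⟨c, hc⟩ := (MvPowerSeries.integralClosure_quotient_isDiscreteValuationRing i.1
    (C.krullDim_eq_one i.1 i.2) (FractionRing (C.BranchRing i))).2.1 u
  have hlt : C.value g i < C.value (g - algebraMap K C.CoordRing c * h) i := by
    have h1 : C.toNormalization i (g - algebraMap K C.CoordRing c * h) = C.toNormalization i h *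
        (u - algebraMap (C.BranchRing i) (C.BranchNormalization i)
          (algebraMap K (C.BranchRing i) c)) := by
      rw [map_sub, map_mul, ← hu, mul_sub, mul_comm (C.toNormalization i (algebraMap K _ c))]
      rfl
    rw [C.value_apply (_ - _), h1, IsDiscreteValuationRing.addVal_mul, ← value_apply, ← hgh]
    refine (ENat.add_one_le_iff hg).mp (add_le_add le_rfl ?_)
    rw [Order.one_le_iff_ne_zero, Ne, IsDiscreteValuationRing.addVal_eq_zero_iff]
    exact hc
  refine ⟨c, ?_, hlt⟩
  rintro rfl
  simp at hlt

/-! ### Conductors, maximal values and absolute points -/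

/-- An element of large value on a branch can be made to vanish on this branch without changing it
on the other ones. -/
theorem exists_conductor [Finite C.Branch] (i : C.Branch) :
    ∃ c : ℕ, ∀ g : C.CoordRing, (c : ℕ∞) ≤ C.value g i →
      ∃ h : C.CoordRing, C.toBranch i h = 0 ∧ ∀ j, j ≠ i → C.toBranch j h = C.toBranch j g := by
  obtain ⟨e, he, he'⟩ := C.exists_toBranch_ne_zero i
  obtain ⟨d, hd, hcond⟩ := (MvPowerSeries.integralClosure_quotient_isDiscreteValuationRing i.1
    (C.krullDim_eq_one i.1 i.2) (FractionRing (C.BranchRing i))).2.2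
  obtain ⟨d, rfl⟩ := C.toBranch_surjective i d
  -- The bound is `v_i(d e)`, with `d` in the conductor and `e` supported on branch `i`: if `g = d e
  -- b` there, then `d b` comes from some `a`, and `g - e a` is the required element.
  have hde : C.value (d * e) i ≠ ⊤ := by
    rw [Ne, value_eq_top_iff, map_mul, mul_eq_zero]
    tauto
  obtain ⟨c, hc⟩ := ENat.ne_top_iff_exists.mp hde
  refine ⟨c, fun g hg => ?_⟩
  rw [hc, value_apply, value_apply, IsDiscreteValuationRing.addVal_le_iff_dvd] at hg
  obtain ⟨b, hb⟩ := hg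
  obtain ⟨a, ha⟩ := hcond b
  obtain ⟨a, rfl⟩ := C.toBranch_surjective i a
  refine ⟨g - e * a, ?_, fun j hj => by rw [map_sub, map_mul, he' j hj, zero_mul, sub_zero]⟩
  rw [← toNormalization_eq_zero_iff, map_sub, hb, map_mul, map_mul]
  change C.toNormalization i d * b = C.toNormalization i a at ha
  rw [← ha]
  ring

/-- The single-branch conductors are applied one branch at a time. Allowing every `c' ≥ c` lets a
threshold be raised above a component that must be preserved. -/
theorem exists_forall_large_value_eq_top [Finite C.Branch] :
    ∃ c : C.Branch → ℕ, ∀ c' : C.Branch → ℕ, c ≤ c' → ∀ g : C.CoordRing, ∃ h : C.CoordRing,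
      ∀ i, ((c' i : ℕ∞) ≤ C.value g i → C.value h i = ⊤) ∧
        (C.value g i < c' i → C.value h i = C.value g i) := by
  classical
  have := Fintype.ofFinite C.Branch
  choose c hc using C.exists_conductor
  refine ⟨c, fun c' hcc' g => ?_⟩
  have key : ∀ S : Finset C.Branch, ∃ h : C.CoordRing,
      (∀ i ∈ S, (c' i : ℕ∞) ≤ C.value g i → C.toBranch i h = 0) ∧
      ∀ i, (i ∉ S ∨ C.value g i < c' i) → C.toBranch i h = C.toBranch i g := by
    intro S
    induction S using Finset.induction_on with
    | empty => exact ⟨g, by simp, fun _ _ => rfl⟩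
    | insert j S hj ih =>
      obtain ⟨h, hS, hSc⟩ := ih
      by_cases hjv : (c' j : ℕ∞) ≤ C.value g j
      · have hvj : C.value h j = C.value g j :=
          congrArg (fun x => radicalOrder (C.BranchNormalization j)
            (algebraMap (C.BranchRing j) (C.BranchNormalization j) x)) (hSc j (Or.inl hj))
        obtain ⟨h', hz, heq⟩ := hc j h
          (hvj ▸ le_trans (Nat.cast_le.mpr (hcc' j)) hjv)
        refine ⟨h', fun i hi hiv => ?_, fun i hi => ?_⟩
        · rcases Finset.mem_insert.mp hi with rfl | hi
          · exact hz
          · rw [heq i (ne_of_mem_of_not_mem hi hj)]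
            exact hS i hi hiv
        · have hij : i ≠ j := by
            rintro rfl
            rcases hi with hi | hi
            · exact hi (Finset.mem_insert_self _ _)
            · exact absurd hjv (not_le.mpr hi)
          rw [heq i hij]
          exact hSc i (hi.imp_left fun h1 h2 => h1 (Finset.mem_insert_of_mem h2))
      · refine ⟨h, fun i hi hiv => ?_, fun i hi => ?_⟩
        · rcases Finset.mem_insert.mp hi with rfl | hi
          · exact absurd hiv hjv
          · exact hS i hi hiv
        · exact hSc i (hi.imp_left fun h1 h2 => h1 (Finset.mem_insert_of_mem h2))
  obtain ⟨h, h1, h2⟩ := key Finset.univ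
  refine ⟨h, fun i => ⟨fun hi => C.value_eq_top_iff.mpr (h1 i (Finset.mem_univ i) hi),
    fun hi => ?_⟩⟩
  exact congrArg (fun x => radicalOrder (C.BranchNormalization i)
    (algebraMap (C.BranchRing i) (C.BranchNormalization i) x)) (h2 i (Or.inr hi))

/-- Among the values above `v(g)` having the same finite `k`-th component there are maximal ones. -/
theorem exists_maximal_value [Finite C.Branch] (g : C.CoordRing) {k : C.Branch}
    (hk : C.value g k ≠ ⊤) :
    ∃ h : C.CoordRing, C.value g ≤ C.value h ∧ C.value h k = C.value g k ∧
      ∀ h' : C.CoordRing, C.value h ≤ C.value h' → C.value h' k = C.value h k →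
        C.value h' = C.value h := by
  classical
  obtain ⟨m, hm⟩ := ENat.ne_top_iff_exists.mp hk
  obtain ⟨c, hc⟩ := C.exists_forall_large_value_eq_top
  -- The summand `m + 1` puts the threshold at `k` above `v_k(g) = m`, which therefore survives.
  let c' : C.Branch → ℕ := fun i => c i + (m + 1)
  have hlift : ∀ g' : C.CoordRing, C.value g' k = C.value g k → ∃ h : C.CoordRing,
      C.value g' ≤ C.value h ∧ C.value h k = C.value g k ∧
      ∀ i, C.value h i < c' i ∨ C.value h i = ⊤ := by
    intro g' hg'
    obtain ⟨h, hh⟩ := hc c' (fun i => Nat.le_add_right _ _) g'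
    refine ⟨h, fun i => ?_, ?_, fun i => ?_⟩
    · rcases lt_or_ge (C.value g' i) (c' i) with hi | hi
      · exact ((hh i).2 hi).ge
      · rw [(hh i).1 hi]
        exact le_top
    · rw [← hg']
      refine (hh k).2 ?_
      rw [hg', ← hm, Nat.cast_lt]
      exact lt_of_lt_of_le (Nat.lt_succ_self m) (Nat.le_add_left _ _)
    · rcases lt_or_ge (C.value g' i) (c' i) with hi | hi
      · exact Or.inl (by rwa [(hh i).2 hi])
      · exact Or.inr ((hh i).1 hi)
  let T : Set (C.Branch → ℕ∞) := {δ | (∃ h, C.value h = δ) ∧ C.value g ≤ δ ∧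
    δ k = C.value g k ∧ ∀ i, δ i < c' i ∨ δ i = ⊤}
  have hTfin : T.Finite := by
    refine (Set.Finite.pi' (t := fun i => insert ⊤ ((fun x : ℕ => (x : ℕ∞)) '' Set.Iio (c' i)))
      fun i => ((Set.finite_Iio _).image _).insert _).subset ?_
    rintro δ ⟨-, -, -, hδ⟩ i
    rcases hδ i with hi | hi
    · obtain ⟨x, hx⟩ := ENat.ne_top_iff_exists.mp (ne_top_of_lt hi)
      refine Or.inr ⟨x, ?_, hx⟩
      rw [← hx, Nat.cast_lt] at hi
      exact hi
    · exact Or.inl hi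
  have hTne : T.Nonempty := by
    obtain ⟨h, h1, h2, h3⟩ := hlift g rfl
    exact ⟨_, ⟨h, rfl⟩, h1, h2, h3⟩
  obtain ⟨δ, hδ⟩ := hTfin.exists_maximal hTne
  obtain ⟨⟨⟨h, rfl⟩, h1, h2, -⟩, hmax⟩ := hδ
  refine ⟨h, h1, h2, fun h' hle hk' => ?_⟩
  obtain ⟨h'', g1, g2, g3⟩ := hlift h' (hk'.trans h2)
  have := hmax (y := C.value h'') ⟨⟨h'', rfl⟩, h1.trans (hle.trans g1), g2, g3⟩ (hle.trans g1)
  exact le_antisymm (g1.trans this) hle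

/-- A value that is maximal among the values above it with the same finite `k`-th component is an
absolute point. -/
theorem isAbsolutePoint_of_maximal {h : C.CoordRing} {k : C.Branch} (hk : C.value h k ≠ ⊤)
    (hmax : ∀ h' : C.CoordRing, C.value h ≤ C.value h' → C.value h' k = C.value h k →
      C.value h' = C.value h) :
    C.IsAbsolutePoint (C.value h) := by
  refine ⟨⟨h, rfl⟩, fun J hJ hJI => Set.eq_empty_iff_forall_notMem.mpr ?_⟩
  rintro _ ⟨⟨h', rfl⟩, hgt, heq⟩
  have hle : C.value h ≤ C.value h' := fun i => by
    by_cases hi : i ∈ C.finiteSupport (C.value h) \ J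
    · exact (hgt i hi).le
    · exact (heq i hi).ge
  -- If `k ∈ J`, then `v(h')` itself contradicts maximality.
  by_cases hkJ : k ∈ J
  · obtain ⟨i, hi, hiJ⟩ := Set.exists_of_ssubset hJI
    have h1 := hgt i ⟨hi, hiJ⟩
    rw [hmax h' hle (heq k fun h => h.2 hkJ)] at h1
    exact lt_irrefl _ h1
  -- If `k ∉ J`, cancelling initial terms at some `j ∈ J` raises the `j`-th value and keeps the
  -- `k`-th, since `h'` has larger value at `k`.
  · obtain ⟨j, hj⟩ := hJ
    have hjeq : C.value h' j = C.value h j := heq j fun h => h.2 hj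
    obtain ⟨c, hc, hlt⟩ := C.exists_value_lt_value_sub (hJI.1 hj) hjeq.symm
    have hle' : C.value h ≤ C.value (h - algebraMap K C.CoordRing c * h') := fun i => by
      refine le_trans ?_ (C.min_le_value_sub _ _ i)
      rw [C.value_algebraMap_mul hc]
      exact le_min le_rfl (hle i)
    have hkeq : C.value (h - algebraMap K C.CoordRing c * h') k = C.value h k :=
      C.value_sub_eq_of_lt_left (by
        rw [C.value_algebraMap_mul hc]
        exact hgt k ⟨hk, hkJ⟩)
    rw [hmax _ hle' hkeq] at hlt
    exact lt_irrefl _ hlt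

/-! ### Products and reductions -/

/-- If every irreducible absolute point is the value of an element of `G`, then above every value
there is the value of a `G`-product with the same `k`-th component. -/
theorem exists_prod_value [Finite C.Branch] (G : Finset C.CoordRing)
    (hG : ∀ γ, C.IsIrreducibleValue γ → C.IsAbsolutePoint γ → ∃ x ∈ G, C.value x = γ)
    (k : C.Branch) (N : ℕ) (g : C.CoordRing) (hg : C.value g k = N) :
    ∃ a : C.CoordRing → ℕ, C.value g ≤ C.value (∏ x ∈ G, x ^ a x) ∧
      C.value (∏ x ∈ G, x ^ a x) k = C.value g k := by
  classical
  induction N using Nat.strong_induction_on generalizing g with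
  | _ N ih =>
    obtain ⟨h, hgh, hk, hmax⟩ := C.exists_maximal_value g (hg ▸ ENat.natCast_ne_top N)
    have hkN : C.value h k = N := hk.trans hg
    have habs := C.isAbsolutePoint_of_maximal (hkN ▸ ENat.natCast_ne_top N) hmax
    suffices ∃ a : C.CoordRing → ℕ, C.value h ≤ C.value (∏ x ∈ G, x ^ a x) ∧
        C.value (∏ x ∈ G, x ^ a x) k = C.value h k by
      obtain ⟨a, h1, h2⟩ := this
      exact ⟨a, hgh.trans h1, h2.trans hk⟩
    by_cases h0 : C.value h = 0
    · exact ⟨0, by simp [h0, value_one], by simp [h0, value_one]⟩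
    by_cases hirr : C.IsIrreducibleValue (C.value h)
    · obtain ⟨x, hx, hxh⟩ := hG _ hirr habs
      have hprod : ∏ y ∈ G, y ^ (Pi.single x 1 : C.CoordRing → ℕ) y = x := by
        rw [Finset.prod_eq_single x (fun y _ hy => by rw [Pi.single_eq_of_ne hy, pow_zero])
          (fun h => absurd hx h), Pi.single_eq_same, pow_one]
      exact ⟨Pi.single x 1, by rw [hprod, hxh], by rw [hprod, hxh]⟩
    · have hsplit : ∃ b b' : C.CoordRing, C.value h = C.value b + C.value b' ∧
          C.value b ≠ C.value h ∧ C.value b' ≠ C.value h := by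
        by_contra hcon
        push Not at hcon
        refine hirr ⟨⟨h, rfl⟩, h0, ?_⟩
        rintro _ ⟨b, rfl⟩ _ ⟨b', rfl⟩ hb
        by_cases h1 : C.value b = C.value h
        · exact Or.inl h1
        · exact Or.inr (hcon b b' hb h1)
      obtain ⟨b, b', hsum, hb, hb'⟩ := hsplit
      -- A nonzero value comes from a nonunit, so all its components are positive; hence both
      -- summands are smaller than `N` at `k`.
      have hpos : ∀ x : C.CoordRing, C.value x ≠ 0 → 0 < C.value x k := fun x hx =>
        C.value_pos_of_mem_maxIdeal (fun hu => hx (C.value_eq_zero_of_isUnit hu)) k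
      have hp := hpos b (fun h1 => hb' (by rw [hsum, h1, zero_add]))
      have hp' := hpos b' (fun h1 => hb (by rw [hsum, h1, add_zero]))
      have hsk : C.value b k + C.value b' k = N := by
        rw [← hkN, hsum, Pi.add_apply]
      have hne : C.value b k ≠ ⊤ := fun h1 => by
        rw [h1, top_add] at hsk
        exact ENat.natCast_ne_top N hsk.symm
      have hne' : C.value b' k ≠ ⊤ := fun h1 => by
        rw [h1, add_top] at hsk
        exact ENat.natCast_ne_top N hsk.symm
      obtain ⟨m, hm⟩ := ENat.ne_top_iff_exists.mp hne
      obtain ⟨m', hm'⟩ := ENat.ne_top_iff_exists.mp hne'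
      rw [← hm] at hp hsk
      rw [← hm'] at hp' hsk
      norm_cast at hp hp' hsk
      obtain ⟨a, h1, h2⟩ := ih m (by omega) b hm.symm
      obtain ⟨a', h1', h2'⟩ := ih m' (by omega) b' hm'.symm
      have hprod : ∏ x ∈ G, x ^ (a + a') x = (∏ x ∈ G, x ^ a x) * ∏ x ∈ G, x ^ a' x := by
        simp only [Pi.add_apply, pow_add, Finset.prod_mul_distrib]
      refine ⟨a + a', ?_, ?_⟩
      · rw [hprod, value_mul, hsum]
        exact add_le_add h1 h1'
      · rw [hprod, value_mul, hsum, Pi.add_apply, Pi.add_apply, h2, h2']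

/-- A `G`-product above `v(g)` with the same finite `k`-th component gives a reduction. -/
theorem hasReduction_of_value_prod {G : Finset C.CoordRing} {g : C.CoordRing} {k : C.Branch}
    (hk : C.value g k ≠ ⊤) {a : C.CoordRing → ℕ}
    (hle : C.value g ≤ C.value (∏ x ∈ G, x ^ a x))
    (heq : C.value (∏ x ∈ G, x ^ a x) k = C.value g k) : C.HasReduction G g := by
  obtain ⟨c, hc, hlt⟩ := C.exists_value_lt_value_sub hk heq.symm
  refine ⟨k, _, ?_, hk, ⟨c, a, rfl⟩, fun i => ?_, hlt⟩
  · rintro rfl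
    exact hk (C.value_eq_top_iff.mpr (map_zero _))
  · refine le_trans ?_ (C.min_le_value_sub _ _ i)
    rw [C.value_algebraMap_mul hc]
    exact le_min le_rfl (hle i)

/-- A reduction of `g` gives a product above `v(g)` with the same finite `k`-th component. -/
theorem HasReduction.exists_value_prod {G : Finset C.CoordRing} {g : C.CoordRing}
    (hred : C.HasReduction G g) : ∃ (k : C.Branch) (a : C.CoordRing → ℕ), C.value g k ≠ ⊤ ∧
      C.value g ≤ C.value (∏ x ∈ G, x ^ a x) ∧
      C.value (∏ x ∈ G, x ^ a x) k = C.value g k := by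
  obtain ⟨k, h, -, hk, ⟨c, a, rfl⟩, hle, hlt⟩ := hred
  have hc : c ≠ 0 := by
    rintro rfl
    simp at hlt
  set p := ∏ x ∈ G, x ^ a x
  -- Up to a nonzero constant, `p` is the difference of `g` and its reduction.
  have hp : C.value p = C.value (g - (g - algebraMap K C.CoordRing c * p)) := by
    rw [sub_sub_cancel, C.value_algebraMap_mul hc]
  refine ⟨k, a, hk, fun i => ?_, ?_⟩
  · rw [hp]
    exact le_trans (le_min le_rfl (hle i)) (C.min_le_value_sub _ _ i)
  · rw [hp]
    exact C.value_sub_eq_of_lt_left hlt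

/-- An irreducible value of a `G`-product is the value of an element of `G`. -/
theorem IsIrreducibleValue.exists_mem_of_prod {G : Finset C.CoordRing} {a : C.CoordRing → ℕ}
    {γ : C.Branch → ℕ∞} (hγ : C.IsIrreducibleValue γ)
    (h : C.value (∏ x ∈ G, x ^ a x) = γ) : ∃ x ∈ G, C.value x = γ := by
  classical
  have hpow : ∀ (x : C.CoordRing) (m : ℕ), C.value (x ^ m) = γ → C.value x = γ := by
    intro x m
    induction m with
    | zero => exact fun h => absurd (by rw [← h, pow_zero, value_one]) hγ.2.1
    | succ m ih =>
      intro h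
      rw [pow_succ, value_mul] at h
      exact (hγ.2.2 _ ⟨_, rfl⟩ _ ⟨_, rfl⟩ h.symm).elim ih id
  induction G using Finset.induction_on with
  | empty => exact absurd (by rw [← h, Finset.prod_empty, value_one]) hγ.2.1
  | insert y G hy ih =>
    rw [Finset.prod_insert hy, value_mul] at h
    rcases hγ.2.2 _ ⟨_, rfl⟩ _ ⟨_, rfl⟩ h.symm with h1 | h1
    · exact ⟨y, Finset.mem_insert_self _ _, hpow _ _ h1⟩
    · obtain ⟨x, hx, hxγ⟩ := ih h1
      exact ⟨x, Finset.mem_insert_of_mem hx, hxγ⟩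

/-- On a curve with several branches, `(∞, …, ∞)` is not irreducible. -/
theorem not_isIrreducibleValue_top [Finite C.Branch] [Nontrivial C.Branch] :
    ¬ C.IsIrreducibleValue ⊤ := by
  intro hirr
  obtain ⟨i, j, hij⟩ := exists_pair_ne C.Branch
  obtain ⟨e, he, he'⟩ := C.exists_toBranch_ne_zero i
  obtain ⟨f, hf, hf'⟩ := C.exists_toBranch_ne_zero j
  -- `e` and `f` live on different branches, so `∞ = v(e) + v(f)` with neither summand `∞`.
  have hef : e * f = 0 := C.eq_zero_of_forall_toBranch fun l => by
    by_cases hl : l = i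
    · rw [map_mul, hf' l (hl ▸ hij), mul_zero]
    · rw [map_mul, he' l hl, zero_mul]
  rcases hirr.2.2 _ ⟨e, rfl⟩ _ ⟨f, rfl⟩
    (by rw [← value_mul, hef, C.value_eq_top_iff_eq_zero.mpr rfl]) with h | h
  · exact he (C.value_eq_top_iff.mp (congrFun h i))
  · exact hf (C.value_eq_top_iff.mp (congrFun h j))

/-- Such an element has no reduction modulo `∅`, which forces a Standard Basis to be nonempty. An
element vanishing on one branch but not on another serves. -/
theorem exists_mem_maxIdeal_ne_zero [Nontrivial C.Branch] [Finite C.Branch] :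
    ∃ g ∈ C.maxIdeal, g ≠ 0 := by
  obtain ⟨i, j, hij⟩ := exists_pair_ne C.Branch
  obtain ⟨e, he, he'⟩ := C.exists_toBranch_ne_zero i
  refine ⟨e, fun hu => ?_, fun h => he (by rw [h, map_zero])⟩
  have h1 := C.value_eq_zero_of_isUnit hu
  have h2 := C.value_eq_top_iff.mpr (he' j hij.symm)
  rw [h1] at h2
  exact ENat.zero_ne_top h2

end AlgebroidCurve

end

/-! ### The theorem -/

theorem corollary20 {K : Type*} [Field K] [IsAlgClosed K] {n : ℕ} (C : AlgebroidCurve K n)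
    (hC : C.Nondegenerate) (hr : 2 ≤ Nat.card C.Branch)
    (G : Finset C.CoordRing) (hGM : ∀ g ∈ G, g ∈ C.maxIdeal)
    (hinj : Set.InjOn C.value (G : Set C.CoordRing))
    (hG : C.value '' (G : Set C.CoordRing) = {γ | C.IsIrreducibleValue γ ∧ C.IsAbsolutePoint γ}) :
    C.IsMinimalStandardBasis G := by
  classical
  -- `Nat.card` is `0` on infinite types, so `hr` also gives finiteness.
  have : Finite C.Branch := Nat.finite_of_card_ne_zero (by omega)
  have : Nontrivial C.Branch := Finite.one_lt_card_iff_nontrivial.mp hr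
  have hmem : ∀ g ∈ G, C.IsIrreducibleValue (C.value g) ∧ C.IsAbsolutePoint (C.value g) :=
    fun g hg => hG.subset ⟨g, hg, rfl⟩
  have hred : ∀ g : C.CoordRing, g ≠ 0 → C.HasReduction G g := by
    intro g hg
    have hk : ∃ k, C.value g k ≠ ⊤ := by
      by_contra hcon
      push Not at hcon
      exact hg (C.value_eq_top_iff_eq_zero.mp (funext hcon))
    obtain ⟨k, hk⟩ := hk
    obtain ⟨N, hN⟩ := ENat.ne_top_iff_exists.mp hk
    obtain ⟨a, h1, h2⟩ := C.exists_prod_value G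
      (fun γ hγ hγ' => hG.superset ⟨hγ, hγ'⟩) k N g hN.symm
    exact C.hasReduction_of_value_prod hk h1 h2
  refine ⟨⟨?_, fun g hg => ⟨hGM g hg, ?_⟩, hred⟩, fun g hg hgred => ?_⟩
  -- The only product over `∅` is `1`, of value `0`, whereas `g` has positive values.
  · obtain ⟨g, hgm, hg⟩ := C.exists_mem_maxIdeal_ne_zero
    by_contra hne
    rw [Finset.not_nonempty_iff_eq_empty] at hne
    obtain ⟨k, a, -, -, h⟩ := (hred g hg).exists_value_prod
    rw [hne, Finset.prod_empty, C.value_one] at h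
    exact (C.value_pos_of_mem_maxIdeal hgm k).ne h
  · intro h0
    have h1 := (hmem g hg).1
    rw [C.value_eq_top_iff_eq_zero.mpr h0] at h1
    exact C.not_isIrreducibleValue_top h1
  · obtain ⟨k, a, hk, hle, heq⟩ := hgred.exists_value_prod
    have hval := (hmem g hg).2.value_eq C hk hle heq
    obtain ⟨x, hx, hxg⟩ := (hmem g hg).1.exists_mem_of_prod C hval
    exact Finset.ne_of_mem_erase hx (hinj (Finset.mem_of_mem_erase hx) hg hxg)
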